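/- Let $T=\{0,1/2,1/3,\dots,1/n,\dots\}$. Let $(\lambda_n)_{n\ge2}$, $(f_n)_{n\ge2}$, $(g_n)_{n\ge2}$ be real sequences with $\lambda_n>0$, $0<f_n<1$ and $0<g_n<1$ for all $n\ge2$, with $\lim_{n\to\infty}\lambda_n=0$, and with $$\sum_{j=2}^\infty\frac{1-f_j}{\lambda_j}<1\quad\text{and}\quad\sum_{j=2}^\infty\frac{1-g_j}{\lambda_j}<1.$$ Define a kernel $U$ on $T\times T$ by $U(0,0)=2$ and, for $i,j\ge2$, $U(0,1/j)=1+g_j$, $U(1/i,0)=1+f_i$ and $U(1/i,1/j)=\lambda_i\delta_{i,j}+1+f_ig_j$. For $\alpha>0$, an $\alpha$-permanental sequence with kernel $U$ is a nonnegative stochastic process $X_{(\alpha)}=\{X_{(\alpha),s},\,s\in T\}$ such that for all $n$, all $t_1,\dots,t_n\in T$ and all $s_1,\dots,s_n\ge0$, $$E\Big(e^{-\sum_{i=1}^n s_iX_{(\alpha),t_i}}\Big)=\frac1{\det(I+KS)^{\alpha}},\qquad K=\big(U(t_i,t_j)\big)_{i,j=1}^n,\quad S=\operatorname{diag}(s_1,\dots,s_n).$$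 **Theorem 1.2.** If $\lim_{n\to\infty}\lambda_n\log n=\infty$, then for every $\alpha>0$ and every $\alpha$-permanental sequence $X_{(\alpha)}$ with kernel $U$, $$\limsup_{n\to\infty}\frac{X_{(\alpha),1/n}}{\lambda_n\log n}=1\qquad\text{almost surely.}$$ -/

import Mathlib

open MeasureTheory Filter Topology

namespace Kolmogorov

/-- An `ℝ₊ⁿ`-valued random variable `X` is an `α`-permanental random variable with kernel `K`:
`E exp (-∑ i, s i * X i) = 1 / det (I + K S) ^ α` for every diagonal matrix `S` with nonnegative
diagonal entries `s i`. -/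
structure IsPermanentalVector {Ω : Type*} [MeasurableSpace Ω] (P : Measure Ω) {n : ℕ}
    (α : ℝ) (K : Matrix (Fin n) (Fin n) ℝ) (X : Ω → Fin n → ℝ) : Prop where
  measurable : Measurable X
  nonneg : ∀ᵐ ω ∂P, ∀ i, 0 ≤ X ω i
  laplace : ∀ s : Fin n → ℝ, (∀ i, 0 ≤ s i) →
    ∫ ω, Real.exp (-∑ i, s i * X ω i) ∂P = 1 / (1 + K * Matrix.diagonal s).det ^ α

/-- A stochastic process `X = {X t, t ∈ I}` is an `α`-permanental process with kernel `K` if for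
all `t₁, …, tₙ` in the index set, `(X t₁, …, X tₙ)` is an `α`-permanental random variable with
kernel `{K (tᵢ) (tⱼ)}`. -/
def IsPermanentalProcess {Ω : Type*} [MeasurableSpace Ω] (P : Measure Ω) {I : Type*}
    (α : ℝ) (K : I → I → ℝ) (X : I → Ω → ℝ) : Prop :=
  ∀ (n : ℕ) (t : Fin n → I),
    IsPermanentalVector P α (Matrix.of fun i j => K (t i) (t j)) (fun ω i => X (t i) ω)

/-- The index set `T = {0, 1/2, 1/3, …, 1/n, …}`. -/
def T : Set ℝ := insert 0 {s : ℝ | ∃ n : ℕ, 2 ≤ n ∧ s = 1 / (n : ℝ)}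

theorem one_div_mem_T {n : ℕ} (hn : 2 ≤ n) : 1 / (n : ℝ) ∈ T := Or.inr ⟨n, hn, rfl⟩

/-- The point `0` of `T`. -/
def zeroPt : T := ⟨0, Or.inl rfl⟩

/-- The point `1/n` of `T` for `n ≥ 2`; the points `n = 0, 1` are sent to `0` and play no role. -/
noncomputable def pt (n : ℕ) : T := if hn : 2 ≤ n then ⟨1 / (n : ℝ), one_div_mem_T hn⟩ else zeroPt

theorem coe_pt {n : ℕ} (hn : 2 ≤ n) : (pt n : ℝ) = 1 / (n : ℝ) := by
  simp [pt, hn]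

/-- The index of a point of `T`: `0` has index `0` and `1/n` has index `n`
(see `idx_zeroPt`, `idx_pt`). -/
noncomputable def idx (s : T) : ℕ := ⌊(s : ℝ)⁻¹⌋₊

theorem idx_zeroPt : idx zeroPt = 0 := by
  simp [idx, zeroPt]

theorem idx_pt {n : ℕ} (hn : 2 ≤ n) : idx (pt n) = n := by
  simp [idx, coe_pt hn]

/-- The matrix `G i j = lam i * δ i j + 1 + f i * g j`. -/
def G (lam f g : ℕ → ℝ) (i j : ℕ) : ℝ := (if i = j then lam i else 0) + 1 + f i * g j

/-- The kernel `U` on `T`, obtained from `G` by identifying the point `0` with the index `0` and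
the point `1/n` with the index `n`. -/
noncomputable def U (lam f g : ℕ → ℝ) (s t : T) : ℝ := G lam f g (idx s) (idx t)

/-- The standing assumptions on the sequences; the values at the index `1` are not used. -/
structure Admissible (lam f g : ℕ → ℝ) : Prop where
  lam_zero : lam 0 = 0
  f_zero : f 0 = 1
  g_zero : g 0 = 1
  f_mem : ∀ n, 2 ≤ n → 0 < f n ∧ f n < 1
  g_mem : ∀ n, 2 ≤ n → 0 < g n ∧ g n < 1
  lam_pos : ∀ n, 2 ≤ n → 0 < lam n
  lam_tendsto : Tendsto lam atTop (𝓝 0)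
  f_summable : Summable fun j : ℕ => (1 - f (j + 2)) / lam (j + 2)
  f_sum_lt : ∑' j : ℕ, (1 - f (j + 2)) / lam (j + 2) < 1
  g_summable : Summable fun j : ℕ => (1 - g (j + 2)) / lam (j + 2)
  g_sum_lt : ∑' j : ℕ, (1 - g (j + 2)) / lam (j + 2) < 1

theorem U_zero_zero {lam f g : ℕ → ℝ} (h : Admissible lam f g) :
    U lam f g zeroPt zeroPt = 2 := by
  simp [U, G, idx_zeroPt, h.lam_zero, h.f_zero, h.g_zero]; norm_num

theorem U_zero_pt {lam f g : ℕ → ℝ} (h : Admissible lam f g) {j : ℕ} (hj : 2 ≤ j) :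
    U lam f g zeroPt (pt j) = 1 + g j := by
  simp [U, G, idx_zeroPt, idx_pt hj, h.lam_zero, h.f_zero]

theorem U_pt_zero {lam f g : ℕ → ℝ} (h : Admissible lam f g) {i : ℕ} (hi : 2 ≤ i) :
    U lam f g (pt i) zeroPt = 1 + f i := by
  have : i ≠ 0 := by omega
  simp [U, G, idx_zeroPt, idx_pt hi, h.g_zero, this]

theorem U_pt_pt (lam f g : ℕ → ℝ) {i j : ℕ} (hi : 2 ≤ i) (hj : 2 ≤ j) :
    U lam f g (pt i) (pt j) = (if i = j then lam i else 0) + 1 + f i * g j := by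
  simp [U, G, idx_pt hi, idx_pt hj]

end Kolmogorov

/-! Write `X n` for the variable at `1/n` and `X 0` for the one at `0`. On finitely many points
`1/n` the kernel is a positive diagonal plus a rank two matrix, so `det (1 + K S)` is the product of
the factors `1 + l i * s i` times a 2×2 determinant. The product raised to `-α` is the Laplace
transform of independent gamma variables with shape `α` and scales `l i`.

Lower bound: the 2×2 determinant to the power `-α` is also a Laplace transform
(`isLaplace_rank_two_det`; this is where the two sum conditions enter). Hence the vector has the law
of independent gammas plus an independent nonnegative vector, and exceeds the gammas in law
(`IsPermanentalVector.measure_forall_le`). A gamma variable of scale `lam n` exceeds `c * lam n *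
log n` with probability at least `c / n` when `c < 1` and `n` is large, and the harmonic series
diverges.

Upper bound: by itself `X n` has a scale that does not tend to `0`, because of the rank two part.
Weighting by `exp (-s₀ * X 0)` with `s₀ = C / lam n` brings the scale down to nearly `lam n` when
`C` is large (`measure_le_and_lt_le`). On `X 0 ≤ M` removing the weight costs `exp (C * M / lam n)`,
which is `n ^ o(1)` because `lam n * log n → ∞`. For `c > 1` the tail probabilities are then
summable. -/

namespace Kolmogorov

open ProbabilityTheory
open scoped NNReal ENNReal BoundedContinuousFunction

/-! ### Laplace transforms of measures on the nonnegative orthant -/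

section Laplace

variable {ι : Type*} [Fintype ι]

/-- The exponential `x ↦ exp (-∑ i, s i * x i)` on the nonnegative orthant. -/
noncomputable def expFun (s x : ι → ℝ≥0) : ℝ := Real.exp (-∑ i, (s i : ℝ) * x i)

theorem expFun_nonneg (s x : ι → ℝ≥0) : 0 ≤ expFun s x := (Real.exp_pos _).le

theorem expFun_le_one (s x : ι → ℝ≥0) : expFun s x ≤ 1 :=
  Real.exp_le_one_iff.2 (neg_nonpos.2 (Finset.sum_nonneg fun _ _ => by positivity))

@[simp] theorem expFun_zero_left (x : ι → ℝ≥0) : expFun 0 x = 1 := by simp [expFun]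

@[simp] theorem expFun_zero_right (s : ι → ℝ≥0) : expFun s 0 = 1 := by simp [expFun]

theorem expFun_add_left (s t x : ι → ℝ≥0) : expFun (s + t) x = expFun s x * expFun t x := by
  simp only [expFun, ← Real.exp_add, Pi.add_apply, NNReal.coe_add, add_mul, Finset.sum_add_distrib,
    neg_add]

theorem expFun_add_right (s x y : ι → ℝ≥0) : expFun s (x + y) = expFun s x * expFun s y := by
  simp only [expFun, ← Real.exp_add, Pi.add_apply, NNReal.coe_add, mul_add, Finset.sum_add_distrib,
    neg_add]

@[fun_prop] theorem continuous_expFun (s : ι → ℝ≥0) : Continuous (expFun s) := by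
  unfold expFun; fun_prop

/-- `expFun s` as a bounded continuous function. -/
noncomputable def expBCF (s : ι → ℝ≥0) : (ι → ℝ≥0) →ᵇ ℝ :=
  BoundedContinuousFunction.ofNormedAddCommGroup (expFun s) (continuous_expFun s) 1 fun x => by
    rw [Real.norm_of_nonneg (expFun_nonneg s x)]; exact expFun_le_one s x

@[simp] theorem expBCF_apply (s x : ι → ℝ≥0) : expBCF s x = expFun s x := rfl

/-- The algebra spanned by the exponentials `expFun s`. -/
noncomputable def expAlgebra (ι : Type*) [Fintype ι] : StarSubalgebra ℝ ((ι → ℝ≥0) →ᵇ ℝ) where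
  toSubalgebra := (Submodule.span ℝ (Set.range (expBCF (ι := ι)))).toSubalgebra
    (Submodule.subset_span ⟨0, by ext; simp⟩) fun x y hx hy => by
      have h := Submodule.mul_mem_mul hx hy
      rw [Submodule.span_mul_span] at h
      refine Submodule.span_mono ?_ h
      rintro _ ⟨_, ⟨s, rfl⟩, _, ⟨t, rfl⟩, rfl⟩
      exact ⟨s + t, by ext; simp [expFun_add_left]⟩
  star_mem' := fun {a} ha => by
    have : star a = a := by ext; simp
    rwa [this]

theorem mem_expAlgebra {f : (ι → ℝ≥0) →ᵇ ℝ} :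
    f ∈ expAlgebra ι ↔ f ∈ Submodule.span ℝ (Set.range (expBCF (ι := ι))) := Iff.rfl

/-- A finite measure on the nonnegative orthant is determined by its Laplace transform. -/
theorem ext_of_integral_expFun {μ ν : Measure (ι → ℝ≥0)} [IsFiniteMeasure μ] [IsFiniteMeasure ν]
    (h : ∀ s, ∫ x, expFun s x ∂μ = ∫ x, expFun s x ∂ν) : μ = ν := by
  classical
  refine ext_of_forall_mem_subalgebra_integral_eq_of_polish (𝕜 := ℝ) (A := expAlgebra ι) ?_ ?_
  · intro x y hxy
    obtain ⟨i, hi⟩ := Function.ne_iff.1 hxy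
    refine ⟨expFun (Pi.single i 1), ⟨_, ⟨expBCF (Pi.single i 1), ?_, rfl⟩, rfl⟩, ?_⟩
    · exact Submodule.subset_span ⟨_, rfl⟩
    · have hs (z : ι → ℝ≥0) : expFun (Pi.single i 1) z = Real.exp (-z i) := by
        rw [expFun, Finset.sum_eq_single i (fun j _ hj => by simp [hj]) (by simp)]
        simp
      change expFun (Pi.single i 1) x ≠ expFun (Pi.single i 1) y
      simpa [hs] using hi
  · intro g hg
    rw [mem_expAlgebra] at hg
    induction hg using Submodule.span_induction with
    | mem x hx => obtain ⟨s, rfl⟩ := hx; exact h s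
    | zero => simp
    | add f g _ _ hf hg =>
      simp only [BoundedContinuousFunction.coe_add, Pi.add_apply]
      rw [integral_add (f.integrable _) (g.integrable _), integral_add (f.integrable _)
        (g.integrable _), hf, hg]
    | smul c f _ hf =>
      simp only [BoundedContinuousFunction.coe_smul, integral_smul, hf]

/-- The Laplace transform of a measure on the nonnegative orthant. -/
noncomputable def laplace (μ : Measure (ι → ℝ≥0)) (s : ι → ℝ≥0) : ℝ≥0∞ :=
  ∫⁻ x, ENNReal.ofReal (expFun s x) ∂μ

@[simp] theorem laplace_zero_right (μ : Measure (ι → ℝ≥0)) : laplace μ 0 = μ Set.univ := by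
  simp [laplace]

theorem ext_of_laplace {μ ν : Measure (ι → ℝ≥0)} [IsFiniteMeasure μ] [IsFiniteMeasure ν]
    (h : laplace μ = laplace ν) : μ = ν := by
  refine ext_of_integral_expFun fun s => ?_
  rw [integral_eq_lintegral_of_nonneg_ae (.of_forall fun x => expFun_nonneg s x)
    (by fun_prop), integral_eq_lintegral_of_nonneg_ae (.of_forall fun x => expFun_nonneg s x)
    (by fun_prop)]
  exact congrArg ENNReal.toReal (congrFun h s)

theorem laplace_conv (μ ν : Measure (ι → ℝ≥0)) [IsFiniteMeasure μ] [IsFiniteMeasure ν]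
    (s : ι → ℝ≥0) :
    laplace ((μ.prod ν).map fun p => p.1 + p.2) s = laplace μ s * laplace ν s := by
  unfold laplace
  rw [lintegral_map (by fun_prop) (by fun_prop), ← lintegral_prod_mul (by fun_prop) (by fun_prop)]
  simp only [expFun_add_right, ENNReal.ofReal_mul (expFun_nonneg _ _)]

/-- The functions that are Laplace transforms of finite measures on the nonnegative orthant. -/
def IsLaplace (φ : (ι → ℝ≥0) → ℝ) : Prop :=
  -- Nonnegativity is required separately because `ENNReal.ofReal` truncates negative values to `0`.
  (∀ s, 0 ≤ φ s) ∧ ∃ μ : Measure (ι → ℝ≥0), ∀ s, laplace μ s = ENNReal.ofReal (φ s)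

theorem isFiniteMeasure_of_laplace {φ : (ι → ℝ≥0) → ℝ} {μ : Measure (ι → ℝ≥0)}
    (h : ∀ s, laplace μ s = ENNReal.ofReal (φ s)) : IsFiniteMeasure μ :=
  ⟨by rw [← laplace_zero_right, h]; exact ENNReal.ofReal_lt_top⟩

namespace IsLaplace

variable {φ ψ : (ι → ℝ≥0) → ℝ}

theorem le_apply_zero (h : IsLaplace φ) (s : ι → ℝ≥0) : φ s ≤ φ 0 := by
  obtain ⟨h0, μ, hμ⟩ := h
  rw [← ENNReal.ofReal_le_ofReal_iff (h0 0), ← hμ, ← hμ]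
  refine lintegral_mono fun x => ENNReal.ofReal_le_ofReal ?_
  simpa using expFun_le_one s x

theorem const {c : ℝ} (hc : 0 ≤ c) : IsLaplace (fun _ : ι → ℝ≥0 => c) :=
  ⟨fun _ => hc, ENNReal.ofReal c • Measure.dirac 0, fun s => by simp [laplace]⟩

theorem add (hφ : IsLaplace φ) (hψ : IsLaplace ψ) : IsLaplace fun s => φ s + ψ s := by
  obtain ⟨h0, μ, hμ⟩ := hφ
  obtain ⟨k0, ν, hν⟩ := hψ
  refine ⟨fun s => add_nonneg (h0 s) (k0 s), μ + ν, fun s => ?_⟩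
  rw [ENNReal.ofReal_add (h0 s) (k0 s), ← hμ, ← hν]
  simp [laplace]

theorem mul (hφ : IsLaplace φ) (hψ : IsLaplace ψ) : IsLaplace fun s => φ s * ψ s := by
  obtain ⟨h0, μ, hμ⟩ := hφ
  obtain ⟨k0, ν, hν⟩ := hψ
  have := isFiniteMeasure_of_laplace hμ
  have := isFiniteMeasure_of_laplace hν
  refine ⟨fun s => mul_nonneg (h0 s) (k0 s), (μ.prod ν).map fun p => p.1 + p.2, fun s => ?_⟩
  rw [ENNReal.ofReal_mul (h0 s), ← hμ, ← hν, ← laplace_conv]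

theorem const_mul {c : ℝ} (hc : 0 ≤ c) (hφ : IsLaplace φ) : IsLaplace fun s => c * φ s :=
  (const hc).mul hφ

theorem pow (hφ : IsLaplace φ) (n : ℕ) : IsLaplace fun s => φ s ^ n := by
  induction n with
  | zero => simpa using const zero_le_one
  | succ n ih => simpa only [pow_succ] using ih.mul hφ

theorem sum {κ : Type*} (S : Finset κ) {f : κ → (ι → ℝ≥0) → ℝ} (h : ∀ k ∈ S, IsLaplace (f k)) :
    IsLaplace fun s => ∑ k ∈ S, f k s := by
  classical
  induction S using Finset.induction_on with
  | empty => simpa using const le_rfl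
  | insert a S ha ih =>
    simp only [Finset.sum_insert ha]
    exact (h a (by simp)).add (ih fun k hk => h k (by simp [hk]))

theorem hasSum {f : ℕ → (ι → ℝ≥0) → ℝ} (hf : ∀ k, IsLaplace (f k))
    (h : ∀ s, HasSum (fun k => f k s) (φ s)) : IsLaplace φ := by
  choose h0 μ hμ using hf
  refine ⟨fun s => (h s).nonneg fun k => h0 k s, Measure.sum μ, fun s => ?_⟩
  rw [← (h s).tsum_eq, ENNReal.ofReal_tsum_of_nonneg (fun k => h0 k s) (h s).summable]
  simp only [laplace, lintegral_sum_measure]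
  exact tsum_congr fun k => hμ k s

theorem exp (hφ : IsLaplace φ) : IsLaplace fun s => Real.exp (φ s) := by
  refine hasSum (f := fun n s => (n.factorial : ℝ)⁻¹ * φ s ^ n)
    (fun n => (hφ.pow n).const_mul (by positivity)) fun s => ?_
  have := NormedSpace.expSeries_div_hasSum_exp (𝔸 := ℝ) (φ s)
  rw [← Real.exp_eq_exp_ℝ] at this
  simpa [div_eq_inv_mul] using this

/-- The power series of `-log (1 - x)` has nonnegative coefficients, and it converges because a
Laplace transform is largest at `0`. -/
theorem neg_log_one_sub (hφ : IsLaplace φ) (h1 : φ 0 < 1) :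
    IsLaplace fun s => -Real.log (1 - φ s) := by
  refine hasSum (f := fun n s => ((n : ℝ) + 1)⁻¹ * φ s ^ (n + 1))
    (fun n => (hφ.pow _).const_mul (by positivity)) fun s => ?_
  have : |φ s| < 1 := by
    rw [abs_of_nonneg (hφ.1 s)]; exact (hφ.le_apply_zero s).trans_lt h1
  simpa [div_eq_inv_mul] using Real.hasSum_pow_div_log_of_abs_lt_one this

/-- Passing through the logarithm and the exponential series reaches every real exponent `α ≥ 0`,
not only integers. -/
theorem one_sub_rpow_neg (hφ : IsLaplace φ) (h1 : φ 0 < 1) {α : ℝ} (hα : 0 ≤ α) :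
    IsLaplace fun s => (1 - φ s) ^ (-α) := by
  have h : (fun s => (1 - φ s) ^ (-α)) = fun s => Real.exp (α * -Real.log (1 - φ s)) := by
    ext s
    rw [Real.rpow_def_of_pos (by linarith [hφ.le_apply_zero s])]
    ring_nf
  rw [h]
  exact ((hφ.neg_log_one_sub h1).const_mul hα).exp

/-- If `φ s = c - ψ s` with `ψ` a Laplace transform and `φ 0 > 0`, then `φ ^ (-α)` is a Laplace
transform. -/
theorem const_sub_rpow_neg (hψ : IsLaplace ψ) {c : ℝ} (h : ψ 0 < c) {α : ℝ} (hα : 0 ≤ α) :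
    IsLaplace fun s => (c - ψ s) ^ (-α) := by
  have hc : 0 < c := (hψ.1 0).trans_lt h
  have h1 : (fun s => (c - ψ s) ^ (-α)) = fun s => c ^ (-α) * (1 - c⁻¹ * ψ s) ^ (-α) := by
    ext s
    have := hψ.le_apply_zero s
    have hle : c⁻¹ * ψ s ≤ 1 := by
      rw [inv_mul_le_one₀ hc]; linarith
    rw [← Real.mul_rpow hc.le (by linarith), mul_sub, mul_inv_cancel_left₀ hc.ne', mul_one]
  rw [h1]
  refine ((hψ.const_mul (inv_nonneg.2 hc.le)).one_sub_rpow_neg ?_ hα).const_mul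
    (Real.rpow_nonneg hc.le _)
  rwa [inv_mul_lt_one₀ hc]

end IsLaplace

end Laplace

/-! ### Gamma distributions and their tails -/

section Gamma

/-- The gamma distribution of shape `a` and rate `r`, as a measure on `ℝ≥0`. -/
noncomputable def gammaNN (a r : ℝ) : Measure ℝ≥0 := (gammaMeasure a r).map Real.toNNReal

variable {a r : ℝ}

theorem isProbabilityMeasure_gammaNN (ha : 0 < a) (hr : 0 < r) :
    IsProbabilityMeasure (gammaNN a r) := by
  have := isProbabilityMeasure_gammaMeasure ha hr
  exact Measure.isProbabilityMeasure_map (by fun_prop)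

/-- Exponential tilting turns the density of rate `r` into a multiple of the one of rate `r + s`.
Negative `s` is allowed, as the Chernoff bound needs it. -/
theorem lintegral_exp_gammaNN (ha : 0 < a) (hr : 0 < r) {s : ℝ} (hs : 0 < r + s) :
    ∫⁻ x, ENNReal.ofReal (Real.exp (-(s * x))) ∂gammaNN a r =
      ENNReal.ofReal ((r / (r + s)) ^ a) := by
  rw [gammaNN, lintegral_map (by fun_prop) (by fun_prop), gammaMeasure,
    lintegral_withDensity_eq_lintegral_mul₀
      (f := gammaPDF a r) (measurable_gammaPDFReal a r).ennreal_ofReal.aemeasurable (by fun_prop)]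
  have h : ∀ x, (gammaPDF a r *
      fun x : ℝ => ENNReal.ofReal (Real.exp (-(s * (x.toNNReal : ℝ))))) x =
      ENNReal.ofReal ((r / (r + s)) ^ a) * gammaPDF a (r + s) x := fun x => by
    rw [Pi.mul_apply]
    rcases lt_or_ge x 0 with hx | hx
    · simp [gammaPDF_of_neg hx]
    · have hGamma := Real.Gamma_pos_of_pos ha
      rw [gammaPDF_of_nonneg hx, gammaPDF_of_nonneg hx, ← ENNReal.ofReal_mul (by positivity),
        ← ENNReal.ofReal_mul (by positivity), Real.div_rpow hr.le hs.le, Real.coe_toNNReal _ hx]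
      congr 1
      have : Real.exp (-((r + s) * x)) = Real.exp (-(r * x)) * Real.exp (-(s * x)) := by
        rw [← Real.exp_add]; ring_nf
      rw [this]
      have := (Real.rpow_pos_of_pos hs a).ne'
      field_simp
  simp_rw [h]
  rw [lintegral_const_mul (f := gammaPDF a (r + s)) _
      (measurable_gammaPDFReal a (r + s)).ennreal_ofReal,
    lintegral_gammaPDF_eq_one ha hs, mul_one]

/-- Chernoff's bound with exponential parameter `θ * r`. -/
theorem gammaNN_Ioi_le (ha : 0 < a) (hr : 0 < r) {θ : ℝ} (h0 : 0 ≤ θ) (h1 : θ < 1) (y : ℝ≥0) :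
    gammaNN a r (Set.Ioi y) ≤
      ENNReal.ofReal ((1 - θ) ^ (-a) * Real.exp (-(θ * (r * y)))) := by
  have hpos : 0 < r + -(θ * r) := by nlinarith
  have h := lintegral_exp_gammaNN ha hr hpos
  have hr' : r / (r + -(θ * r)) = (1 - θ)⁻¹ := by
    have : 1 - θ ≠ 0 := by linarith
    rw [inv_eq_one_div, div_eq_div_iff hpos.ne' this]; ring
  rw [hr', Real.inv_rpow (by linarith), ← Real.rpow_neg (by linarith)] at h
  have hm := mul_meas_ge_le_lintegral₀ (μ := gammaNN a r)
    (f := fun x => ENNReal.ofReal (Real.exp (-(-(θ * r) * x)))) (by fun_prop)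
    (ENNReal.ofReal (Real.exp (θ * (r * y))))
  rw [h] at hm
  have hsub : gammaNN a r (Set.Ioi y) ≤ gammaNN a r {x : ℝ≥0 |
      ENNReal.ofReal (Real.exp (θ * (r * y))) ≤ ENNReal.ofReal (Real.exp (-(-(θ * r) * x)))} := by
    refine measure_mono fun x hx => ENNReal.ofReal_le_ofReal (Real.exp_le_exp.2 ?_)
    have hx : (y : ℝ) ≤ x := NNReal.coe_le_coe.2 (le_of_lt hx)
    have := mul_le_mul_of_nonneg_left hx (mul_nonneg h0 hr.le)
    linarith
  rw [Real.exp_neg, ← div_eq_mul_inv, ENNReal.ofReal_div_of_pos (Real.exp_pos _),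
    ENNReal.le_div_iff_mul_le (by simp [Real.exp_pos]) (by simp), mul_comm]
  exact (mul_le_mul_right hsub _).trans hm

/-- Far out, the gamma density dominates `r * exp (-(1 + δ) * r * x)`, since `exp (δ * v)` absorbs
any power of `v = r * x`. Only `r * x` matters, so the threshold `u` serves all rates. -/
theorem exists_le_gammaNN_Ioi (ha : 0 < a) {δ : ℝ} (hδ : 0 < δ) :
    ∃ u : ℝ, ∀ r : ℝ, 0 < r → ∀ y : ℝ≥0, u ≤ r * y →
      ENNReal.ofReal (Real.exp (-((1 + δ) * (r * y))) / (1 + δ)) ≤ gammaNN a r (Set.Ioi y) := by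
  obtain ⟨u, hu⟩ := eventually_atTop.1
    ((tendsto_exp_mul_div_rpow_atTop (-(a - 1)) δ hδ).eventually_ge_atTop (Real.Gamma a))
  have hG := Real.Gamma_pos_of_pos ha
  -- The `1` forces `y > 0`, away from the possible singularity of the density at `0`.
  refine ⟨max u 1, fun r hr y hy => ?_⟩
  have hy0 : 0 < (y : ℝ) := by
    have : 0 < r * (y : ℝ) := zero_lt_one.trans_le ((le_max_right _ _).trans hy)
    exact (mul_pos_iff_of_pos_left hr).1 this
  have hpre : Real.toNNReal ⁻¹' Set.Ioi y = Set.Ioi (y : ℝ) := by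
    ext x; simp [Real.lt_toNNReal_iff_coe_lt]
  rw [gammaNN, Measure.map_apply (by fun_prop) measurableSet_Ioi, hpre, gammaMeasure,
    withDensity_apply _ measurableSet_Ioi]
  have hint : IntegrableOn (fun x => r * Real.exp (-((1 + δ) * r) * x)) (Set.Ioi (y : ℝ)) :=
    (integrableOn_exp_mul_Ioi (by have := mul_pos hδ hr; nlinarith) _).const_mul _
  have hval : ∫ x in Set.Ioi (y : ℝ), r * Real.exp (-((1 + δ) * r) * x) =
      Real.exp (-((1 + δ) * (r * y))) / (1 + δ) := by
    rw [integral_const_mul, integral_exp_mul_Ioi (by have := mul_pos hδ hr; nlinarith)]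
    have : -((1 + δ) * (r * y)) = -((1 + δ) * r) * y := by ring
    rw [this]
    have : 1 + δ ≠ 0 := by linarith
    field_simp
  rw [← hval, ofReal_integral_eq_lintegral_ofReal hint (.of_forall fun x => by positivity)]
  refine setLIntegral_mono (measurable_gammaPDFReal a r).ennreal_ofReal fun x hx => ?_
  have hxy : (y : ℝ) < x := hx
  have hx0 : 0 < x := hy0.trans hxy
  rw [gammaPDF_of_nonneg hx0.le]
  refine ENNReal.ofReal_le_ofReal ?_
  have hk := hu (r * x) ((le_max_left _ _).trans (hy.trans (by gcongr)))
  have hp := Real.rpow_pos_of_pos (mul_pos hr hx0) (a - 1)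
  rw [Real.rpow_neg (mul_pos hr hx0).le, div_inv_eq_mul] at hk
  have he : Real.exp (-((1 + δ) * r) * x) = Real.exp (-(r * x)) * (Real.exp (δ * (r * x)))⁻¹ := by
    rw [← Real.exp_neg, ← Real.exp_add]; ring_nf
  have hra : r ^ a * x ^ (a - 1) = r * (r * x) ^ (a - 1) := by
    rw [Real.mul_rpow hr.le hx0.le, ← mul_assoc, Real.rpow_sub_one hr.ne']
    field_simp
  have hE := Real.exp_pos (δ * (r * x))
  calc r * Real.exp (-((1 + δ) * r) * x)
      = r * Real.exp (-(r * x)) * (Real.exp (δ * (r * x)))⁻¹ := by rw [he]; ring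
    _ ≤ r * Real.exp (-(r * x)) * ((r * x) ^ (a - 1) / Real.Gamma a) := by
        gcongr
        rw [inv_le_iff_one_le_mul₀ hE, div_mul_eq_mul_div, one_le_div hG]
        linarith
    _ = (r ^ a * x ^ (a - 1)) / Real.Gamma a * Real.exp (-(r * x)) := by rw [hra]; ring
    _ = r ^ a / Real.Gamma a * x ^ (a - 1) * Real.exp (-(r * x)) := by ring

end Gamma

/-! ### Product measures and convolution -/

section Product

variable {ι : Type*} [Fintype ι]

theorem laplace_pi (ν : ι → Measure ℝ≥0) [∀ i, IsProbabilityMeasure (ν i)] (s : ι → ℝ≥0) :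
    laplace (Measure.pi ν) s =
      ∏ i, ∫⁻ x, ENNReal.ofReal (Real.exp (-((s i : ℝ) * x))) ∂ν i := by
  have h1 : ∀ i, ∫⁻ x, ENNReal.ofReal (Real.exp (-((s i : ℝ) * x))) ∂ν i =
      ENNReal.ofReal (∫ x, Real.exp (-((s i : ℝ) * x)) ∂ν i) := fun i => by
    rw [ofReal_integral_eq_lintegral_ofReal _ (.of_forall fun x => (Real.exp_pos _).le)]
    refine Integrable.of_bound (by fun_prop) 1 (.of_forall fun x => ?_)
    rw [Real.norm_of_nonneg (Real.exp_pos _).le]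
    exact Real.exp_le_one_iff.2 (by have : 0 ≤ (s i : ℝ) * x := by positivity
                                    linarith)
  simp_rw [h1]
  rw [← ENNReal.ofReal_prod_of_nonneg fun i _ => integral_nonneg fun x => (Real.exp_pos _).le,
    ← integral_fintype_prod_eq_prod (𝕜 := ℝ), laplace]
  simp_rw [← Real.exp_sum, Finset.sum_neg_distrib]
  exact (ofReal_integral_eq_lintegral_ofReal ((expBCF s).integrable _)
    (.of_forall fun x => expFun_nonneg s x)).symm

theorem isLaplace_gamma {a r : ℝ} (ha : 0 < a) (hr : 0 < r) (i : ι) :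
    IsLaplace fun s : ι → ℝ≥0 => (r / (r + s i)) ^ a := by
  classical
  refine ⟨fun s => by positivity, (gammaNN a r).map fun x => Pi.single i x, fun s => ?_⟩
  have hm : Measurable (fun x : ℝ≥0 => (Pi.single i x : ι → ℝ≥0)) := measurable_pi_iff.2 fun j => by
    by_cases h : j = i
    · subst h; simpa using measurable_id'
    · simp [h]
  rw [laplace, lintegral_map (by fun_prop) hm, ← lintegral_exp_gammaNN ha hr (by positivity)]
  refine lintegral_congr fun x => ?_
  rw [expFun, Finset.sum_eq_single i (fun j _ hj => by simp [hj]) (by simp)]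
  simp

/-- Adding an independent nonnegative vector decreases the probabilities of lower orthants. -/
theorem conv_pi_Iic_le (ν : ι → Measure ℝ≥0) [∀ i, IsProbabilityMeasure (ν i)]
    (μ : Measure (ι → ℝ≥0)) [IsProbabilityMeasure μ] (t : ι → ℝ≥0) :
    (((Measure.pi ν).prod μ).map fun p => p.1 + p.2) (Set.Iic t) ≤ ∏ i, ν i (Set.Iic (t i)) := by
  rw [Measure.map_apply (by fun_prop) measurableSet_Iic]
  calc _ ≤ ((Measure.pi ν).prod μ) ((Set.univ.pi fun i => Set.Iic (t i)) ×ˢ Set.univ) := by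
        refine measure_mono fun p hp => ⟨fun i _ => ?_, trivial⟩
        exact (le_add_of_nonneg_right zero_le).trans (hp i)
    _ = _ := by rw [Measure.prod_prod, Measure.pi_pi]; simp

end Product

/-! ### The determinant of a diagonal plus rank two kernel -/

section RankTwo

variable {ι : Type*} [Fintype ι]

/-- Matrix determinant lemma: the matrix is `A + V * W` with `A` diagonal and `V` having the two
columns `1` and `f`. -/
theorem det_one_add_diagonal_add_rank_two_mul_diagonal [DecidableEq ι] (l f g s : ι → ℝ)
    (h : ∀ i, 1 + l i * s i ≠ 0) :
    (1 + Matrix.of (fun i j => (if i = j then l i else 0) + 1 + f i * g j) *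
        Matrix.diagonal s).det =
      (∏ i, (1 + l i * s i)) *
        ((1 + ∑ i, s i / (1 + l i * s i)) * (1 + ∑ i, f i * g i * (s i / (1 + l i * s i))) -
          (∑ i, f i * (s i / (1 + l i * s i))) * ∑ i, g i * (s i / (1 + l i * s i))) := by
  let A : Matrix ι ι ℝ := Matrix.diagonal fun i => 1 + l i * s i
  let B : Matrix ι ι ℝ := Matrix.diagonal fun i => (1 + l i * s i)⁻¹
  let V : Matrix ι (Fin 2) ℝ := Matrix.of fun i => ![1, f i]
  let W : Matrix (Fin 2) ι ℝ := Matrix.of ![fun j => s j, fun j => g j * s j]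
  have hdet : A.det = ∏ i, (1 + l i * s i) := Matrix.det_diagonal
  have hAB : A⁻¹ = B := Matrix.inv_eq_right_inv (by simp [A, B, h, ← Pi.one_def])
  have hsplit : 1 + Matrix.of (fun i j => (if i = j then l i else 0) + 1 + f i * g j) *
      Matrix.diagonal s = A + V * W := by
    ext i j
    simp only [Matrix.add_apply, Matrix.one_apply, Matrix.mul_diagonal, A,
      Matrix.diagonal_apply, Matrix.mul_apply (M := V), Fin.sum_univ_two]
    simp only [V, W, Matrix.of_apply]
    by_cases hij : i = j
    · subst hij; simp; ring
    · simp [hij]; ring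
  rw [hsplit, Matrix.det_add_mul _ _ (by
    rw [hdet]; exact (Finset.prod_ne_zero_iff.2 fun i _ => h i).isUnit), hdet, hAB,
    Matrix.det_fin_two]
  congr 1
  have hWBV : ∀ p q, (W * B * V) p q = ∑ i, W p i * (1 + l i * s i)⁻¹ * V i q := fun p q => by
    rw [Matrix.mul_apply]
    exact Finset.sum_congr rfl fun i _ => by rw [Matrix.mul_diagonal]
  simp only [Matrix.add_apply, hWBV, Matrix.one_apply]
  have e1 : ∑ i, W 0 i * (1 + l i * s i)⁻¹ * V i 0 = ∑ i, s i / (1 + l i * s i) :=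
    Finset.sum_congr rfl fun i _ => by simp [W, V, div_eq_mul_inv]
  have e2 : ∑ i, W 0 i * (1 + l i * s i)⁻¹ * V i 1 = ∑ i, f i * (s i / (1 + l i * s i)) :=
    Finset.sum_congr rfl fun i _ => by simp [W, V]; ring
  have e3 : ∑ i, W 1 i * (1 + l i * s i)⁻¹ * V i 0 = ∑ i, g i * (s i / (1 + l i * s i)) :=
    Finset.sum_congr rfl fun i _ => by simp [W, V]; ring
  have e4 : ∑ i, W 1 i * (1 + l i * s i)⁻¹ * V i 1 = ∑ i, f i * g i * (s i / (1 + l i * s i)) :=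
    Finset.sum_congr rfl fun i _ => by simp [W, V]; ring
  rw [e1, e2, e3, e4]
  simp

/-- The determinant of `1 + V W` where `V W` is the matrix `1 + f i * g j` weighted by
`s i / (1 + l i * s i)`. -/
noncomputable def rankTwoDet (l f g : ι → ℝ) (s : ι → ℝ≥0) : ℝ :=
  (1 + ∑ i, s i / (1 + l i * s i)) * (1 + ∑ i, f i * g i * (s i / (1 + l i * s i))) -
    (∑ i, f i * (s i / (1 + l i * s i))) * ∑ i, g i * (s i / (1 + l i * s i))

@[simp] theorem rankTwoDet_zero (l f g : ι → ℝ) : rankTwoDet l f g 0 = 1 := by simp [rankTwoDet]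

/-- The rank two determinant as a difference of products of two increasing and two decreasing
factors. -/
theorem rank_two_det_eq (f g d : ι → ℝ) :
    (1 + ∑ i, d i) * (1 + ∑ i, f i * g i * d i) - (∑ i, f i * d i) * ∑ i, g i * d i =
      (1 + ∑ i, f i * g i * d i) * (2 + ∑ i, (1 - f i) * (1 - g i) * d i) -
        (1 - ∑ i, f i * (1 - g i) * d i) * (1 - ∑ i, g i * (1 - f i) * d i) := by
  have e1 : ∑ i, (1 - f i) * (1 - g i) * d i =
      ∑ i, d i - ∑ i, f i * d i - ∑ i, g i * d i + ∑ i, f i * g i * d i := by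
    rw [← Finset.sum_sub_distrib, ← Finset.sum_sub_distrib, ← Finset.sum_add_distrib]
    exact Finset.sum_congr rfl fun i _ => by ring
  have e2 : ∑ i, f i * (1 - g i) * d i = ∑ i, f i * d i - ∑ i, f i * g i * d i := by
    rw [← Finset.sum_sub_distrib]
    exact Finset.sum_congr rfl fun i _ => by ring
  have e3 : ∑ i, g i * (1 - f i) * d i = ∑ i, g i * d i - ∑ i, f i * g i * d i := by
    rw [← Finset.sum_sub_distrib]
    exact Finset.sum_congr rfl fun i _ => by ring
  rw [e1, e2, e3]
  ring

theorem isLaplace_sum_mul_gamma {r c : ι → ℝ} (hr : ∀ i, 0 < r i) (hc : ∀ i, 0 ≤ c i) :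
    IsLaplace fun s : ι → ℝ≥0 => ∑ i, c i * (r i / (r i + s i)) := by
  refine IsLaplace.sum _ fun i _ => ?_
  simpa using (isLaplace_gamma one_pos (hr i) i).const_mul (hc i)

/-- Each `s / (1 + l * s)` is `1 / l` times one minus the Laplace transform of an exponential
variable of rate `1 / l`. -/
theorem sum_mul_div_eq {l : ι → ℝ} (hl : ∀ i, 0 < l i) (c : ι → ℝ) (s : ι → ℝ≥0) :
    ∑ i, c i * (s i / (1 + l i * s i)) =
      ∑ i, c i / l i - ∑ i, c i / l i * ((1 / l i) / (1 / l i + s i)) := by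
  rw [← Finset.sum_sub_distrib]
  refine Finset.sum_congr rfl fun i _ => ?_
  have h0 := hl i
  have h1 : 0 < 1 + l i * s i := by positivity
  have h2 : 1 / l i + s i = (1 + l i * s i) / l i := by field_simp
  rw [h2]
  field_simp
  ring

/-- In the form `A * B - C * E` of `rank_two_det_eq`, `A` and `B` are constants minus Laplace
transforms, while `C` and `E` are Laplace transforms. So `A * B * (1 - C * E / (A * B))` has all its
factors in the scope of the negative power lemmas. -/
theorem isLaplace_rank_two_det {l f g : ι → ℝ} (hl : ∀ i, 0 < l i)
    (hf : ∀ i, 0 ≤ f i ∧ f i ≤ 1) (hg : ∀ i, 0 ≤ g i ∧ g i ≤ 1)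
    (hfs : ∑ i, (1 - f i) / l i ≤ 1) (hgs : ∑ i, (1 - g i) / l i ≤ 1) {α : ℝ} (hα : 0 ≤ α) :
    (∀ s : ι → ℝ≥0, 0 ≤ rankTwoDet l f g s) ∧
      IsLaplace fun s : ι → ℝ≥0 => rankTwoDet l f g s ^ (-α) := by
  let ψ (c : ι → ℝ) (s : ι → ℝ≥0) : ℝ := ∑ i, c i / l i * ((1 / l i) / (1 / l i + s i))
  have hr : ∀ i, 0 < 1 / l i := fun i => one_div_pos.2 (hl i)
  have hψ : ∀ c : ι → ℝ, (∀ i, 0 ≤ c i) → IsLaplace (ψ c) := fun c hc =>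
    isLaplace_sum_mul_gamma hr fun i => div_nonneg (hc i) (hl i).le
  have hψ0 : ∀ c, ψ c 0 = ∑ i, c i / l i := fun c =>
    Finset.sum_congr rfl fun i _ => by simp [(hl i).ne']
  let A (s : ι → ℝ≥0) : ℝ := 1 + ∑ i, f i * g i / l i - ψ (fun i => f i * g i) s
  let B (s : ι → ℝ≥0) : ℝ :=
    2 + ∑ i, (1 - f i) * (1 - g i) / l i - ψ (fun i => (1 - f i) * (1 - g i)) s
  let C (s : ι → ℝ≥0) : ℝ := 1 - ∑ i, f i * (1 - g i) / l i + ψ (fun i => f i * (1 - g i)) s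
  let E (s : ι → ℝ≥0) : ℝ := 1 - ∑ i, g i * (1 - f i) / l i + ψ (fun i => g i * (1 - f i)) s
  have hfg : ∀ i, 0 ≤ f i * g i := fun i => mul_nonneg (hf i).1 (hg i).1
  have hhk : ∀ i, 0 ≤ (1 - f i) * (1 - g i) := fun i =>
    mul_nonneg (sub_nonneg.2 (hf i).2) (sub_nonneg.2 (hg i).2)
  have hfk : ∀ i, 0 ≤ f i * (1 - g i) := fun i => mul_nonneg (hf i).1 (sub_nonneg.2 (hg i).2)
  have hgh : ∀ i, 0 ≤ g i * (1 - f i) := fun i => mul_nonneg (hg i).1 (sub_nonneg.2 (hf i).2)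
  have hA (β : ℝ) (hβ : 0 ≤ β) : IsLaplace fun s => A s ^ (-β) :=
    (hψ _ hfg).const_sub_rpow_neg (by rw [hψ0]; linarith) hβ
  have hB (β : ℝ) (hβ : 0 ≤ β) : IsLaplace fun s => B s ^ (-β) :=
    (hψ _ hhk).const_sub_rpow_neg (by rw [hψ0]; linarith) hβ
  -- The sum conditions are what make the constant terms of `C` and `E` nonnegative.
  have hC : IsLaplace C := by
    refine (IsLaplace.const (sub_nonneg.2 ?_)).add (hψ _ hfk)
    refine le_trans (Finset.sum_le_sum fun i _ => ?_) hgs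
    exact div_le_div_of_nonneg_right
      (mul_le_of_le_one_left (sub_nonneg.2 (hg i).2) (hf i).2) (hl i).le
  have hE : IsLaplace E := by
    refine (IsLaplace.const (sub_nonneg.2 ?_)).add (hψ _ hgh)
    refine le_trans (Finset.sum_le_sum fun i _ => ?_) hfs
    exact div_le_div_of_nonneg_right
      (mul_le_of_le_one_left (sub_nonneg.2 (hf i).2) (hg i).2) (hl i).le
  have hApos : ∀ s, 0 < A s := fun s => by
    have := (hψ _ hfg).le_apply_zero s
    rw [hψ0] at this
    simp only [A]; linarith
  have hBpos : ∀ s, 0 < B s := fun s => by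
    have := (hψ _ hhk).le_apply_zero s
    rw [hψ0] at this
    simp only [B]; linarith
  have hW : IsLaplace fun s => C s * E s * (A s ^ (-1 : ℝ) * B s ^ (-1 : ℝ)) :=
    (hC.mul hE).mul ((hA 1 zero_le_one).mul (hB 1 zero_le_one))
  -- At `0` the four factors are `1, 2, 1, 1`, so the ratio is `1/2`.
  have hW0 : C 0 * E 0 * (A 0 ^ (-1 : ℝ) * B 0 ^ (-1 : ℝ)) < 1 := by
    have a0 : A 0 = 1 := by simp only [A, hψ0]; ring
    have b0 : B 0 = 2 := by simp only [B, hψ0]; ring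
    have c0 : C 0 = 1 := by simp only [C, hψ0]; ring
    have e0 : E 0 = 1 := by simp only [E, hψ0]; ring
    rw [a0, b0, c0, e0, Real.rpow_neg_one, Real.rpow_neg_one]
    norm_num
  have key := ((hA α hα).mul (hB α hα)).mul (hW.one_sub_rpow_neg hW0 hα)
  have hW1 : ∀ s, 0 < 1 - C s * E s * (A s ^ (-1 : ℝ) * B s ^ (-1 : ℝ)) := fun s =>
    sub_pos.2 ((hW.le_apply_zero s).trans_lt hW0)
  have hdet : ∀ s, rankTwoDet l f g s =
      A s * B s * (1 - C s * E s * (A s ^ (-1 : ℝ) * B s ^ (-1 : ℝ))) := fun s => by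
    have h1 := (hApos s).ne'
    have h2 := (hBpos s).ne'
    rw [rankTwoDet, rank_two_det_eq, sum_mul_div_eq hl, sum_mul_div_eq hl, sum_mul_div_eq hl,
      sum_mul_div_eq hl, Real.rpow_neg_one, Real.rpow_neg_one]
    have h4 : A s * B s * (1 - C s * E s * ((A s)⁻¹ * (B s)⁻¹)) = A s * B s - C s * E s := by
      field_simp
    rw [h4]
    simp only [A, B, C, E, ψ]
    ring
  refine ⟨fun s => ?_, ?_⟩
  · rw [hdet]
    exact (mul_pos (mul_pos (hApos s) (hBpos s)) (hW1 s)).le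
  · convert key using 2 with s
    rw [hdet, Real.mul_rpow (mul_pos (hApos s) (hBpos s)).le (hW1 s).le,
      Real.mul_rpow (hApos s).le (hBpos s).le]

end RankTwo

/-! ### Comparison of permanental vectors with gamma variables -/

section Permanental

variable {Ω : Type*} [MeasurableSpace Ω] {P : Measure Ω}

/-- Orthant probabilities of a permanental vector whose kernel is a diagonal matrix plus
`1 + f i * g j` are dominated by those of independent gamma variables. -/
theorem IsPermanentalVector.measure_forall_le [IsProbabilityMeasure P] {n : ℕ} {α : ℝ}
    (hα : 0 < α) {l f g : Fin n → ℝ}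
    {X : Ω → Fin n → ℝ} (hl : ∀ i, 0 < l i)
    (hf : ∀ i, 0 ≤ f i ∧ f i ≤ 1) (hg : ∀ i, 0 ≤ g i ∧ g i ≤ 1)
    (hfs : ∑ i, (1 - f i) / l i ≤ 1) (hgs : ∑ i, (1 - g i) / l i ≤ 1)
    (hX : IsPermanentalVector P α
      (Matrix.of fun i j => (if i = j then l i else 0) + 1 + f i * g j) X) (t : Fin n → ℝ≥0) :
    P {ω | ∀ i, X ω i ≤ t i} ≤ ∏ i, gammaNN α (1 / l i) (Set.Iic (t i)) := by
  have hr : ∀ i, 0 < 1 / l i := fun i => one_div_pos.2 (hl i)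
  have hν := fun i => isProbabilityMeasure_gammaNN hα (hr i)
  obtain ⟨hd, -, μ, hμ⟩ := isLaplace_rank_two_det hl hf hg hfs hgs hα.le
  have := isFiniteMeasure_of_laplace hμ
  have hμ1 : IsProbabilityMeasure μ := ⟨by rw [← laplace_zero_right, hμ]; simp⟩
  have hXm := hX.measurable
  let Y : Ω → Fin n → ℝ≥0 := fun ω i => (X ω i).toNNReal
  have hY : Measurable Y := by fun_prop
  -- The Laplace transform factors as that of the independent gammas times that of `μ`, and it
  -- determines the law.
  have hlaw : P.map Y =
      ((Measure.pi fun i => gammaNN α (1 / l i)).prod μ).map fun p => p.1 + p.2 := by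
    have : IsProbabilityMeasure (P.map Y) := Measure.isProbabilityMeasure_map hY.aemeasurable
    refine ext_of_laplace (funext fun s => ?_)
    rw [laplace_conv, hμ, laplace_pi]
    have hlg : ∏ i, ∫⁻ x, ENNReal.ofReal (Real.exp (-((s i : ℝ) * x))) ∂gammaNN α (1 / l i) =
        ∏ i, ENNReal.ofReal ((1 / l i / (1 / l i + s i)) ^ α) :=
      Finset.prod_congr rfl fun i _ =>
        lintegral_exp_gammaNN hα (hr i) (add_pos_of_pos_of_nonneg (hr i) (s i).2)
    rw [hlg, ← ENNReal.ofReal_prod_of_nonneg (fun i _ => by have := hl i; positivity),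
      ← ENNReal.ofReal_mul (Finset.prod_nonneg fun i _ => by have := hl i; positivity)]
    have h1 : ∀ i, 0 < 1 + l i * s i := fun i => by have := hl i; positivity
    have hlap := hX.laplace (fun i => s i) fun i => (s i).2
    rw [det_one_add_diagonal_add_rank_two_mul_diagonal _ _ _ _ fun i => (h1 i).ne'] at hlap
    have hprod : ∏ i, (1 / l i / (1 / l i + s i)) ^ α = (∏ i, (1 + l i * s i)) ^ (-α) := by
      rw [← Real.finsetProd_rpow _ _ fun i _ => (h1 i).le]
      refine Finset.prod_congr rfl fun i _ => ?_
      rw [Real.rpow_neg (h1 i).le, ← Real.inv_rpow (h1 i).le]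
      congr 1
      have := (hl i).ne'
      field_simp
    rw [Kolmogorov.laplace, lintegral_map (by fun_prop) hY,
      ← ofReal_integral_eq_lintegral_ofReal _ (.of_forall fun x => expFun_nonneg s _)]
    · congr 1
      have hae : ∀ᵐ ω ∂P, expFun s (Y ω) = Real.exp (-∑ i, s i * X ω i) := by
        filter_upwards [hX.nonneg] with ω hω
        simp only [expFun, Y, Real.coe_toNNReal _ (hω _)]
      rw [integral_congr_ae hae, hlap, hprod, one_div, ← rankTwoDet,
        Real.mul_rpow (Finset.prod_nonneg fun i _ => (h1 i).le) (hd s), mul_inv,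
        Real.rpow_neg (Finset.prod_nonneg fun i _ => (h1 i).le)]
      exact congrArg _ (Real.rpow_neg (hd s) α).symm
    · exact Integrable.of_bound (by fun_prop) 1 (.of_forall fun x => by
        rw [Real.norm_of_nonneg (expFun_nonneg s _)]; exact expFun_le_one s _)
  have hset : {ω | ∀ i, X ω i ≤ t i} ⊆ Y ⁻¹' Set.Iic t := fun ω hω i =>
    Real.toNNReal_le_iff_le_coe.2 (hω i)
  refine (measure_mono hset).trans ?_
  rw [← Measure.map_apply hY measurableSet_Iic, hlaw]
  exact conv_pi_Iic_le _ _ t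

/-- If `V, Z` are nonnegative with `E exp (-(s₀ V + s Z)) = (a + b s) ^ (-α)` for all `s ≥ 0`, then
`Z` has a gamma distribution under the density `exp (-s₀ V)`; this is the resulting tail bound. -/
theorem measure_le_and_lt_le [IsProbabilityMeasure P] {V Z : Ω → ℝ} (hV : Measurable V)
    (hZ : Measurable Z) (hV0 : ∀ᵐ ω ∂P, 0 ≤ V ω) (hZ0 : ∀ᵐ ω ∂P, 0 ≤ Z ω)
    {s₀ a b α θ : ℝ} (hs₀ : 0 ≤ s₀) (ha : 0 < a) (hb : 0 < b) (hα : 0 < α)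
    (hθ0 : 0 ≤ θ) (hθ1 : θ < 1)
    (h : ∀ s : ℝ, 0 ≤ s → ∫ ω, Real.exp (-(s₀ * V ω + s * Z ω)) ∂P = 1 / (a + b * s) ^ α)
    (M : ℝ) (y : ℝ≥0) :
    P {ω | V ω ≤ M ∧ y < Z ω} ≤ ENNReal.ofReal (Real.exp (s₀ * M) *
      (a ^ (-α) * ((1 - θ) ^ (-α) * Real.exp (-(θ * (a / b * y)))))) := by
  -- Under `Q`, which has total mass `a ^ (-α)`, the law of `Z` is that multiple of the gamma law of
  -- shape `α` and rate `a / b`.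
  let Q : Measure Ω := P.withDensity fun ω => ENNReal.ofReal (Real.exp (-(s₀ * V ω)))
  let Y : Ω → Unit → ℝ≥0 := fun ω _ => (Z ω).toNNReal
  have hY : Measurable Y := by fun_prop
  have hr : 0 < a / b := div_pos ha hb
  have hν := isProbabilityMeasure_gammaNN hα hr
  have hint : ∀ s : ℝ, 0 ≤ s → Integrable (fun ω => Real.exp (-(s₀ * V ω + s * Z ω))) P :=
    fun s hs => by
      refine Integrable.of_bound (by fun_prop) 1 ?_
      filter_upwards [hV0, hZ0] with ω h1 h2
      rw [Real.norm_of_nonneg (Real.exp_pos _).le]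
      exact Real.exp_le_one_iff.2 (neg_nonpos.2 (by positivity))
  have hlap : laplace (Q.map Y) =
      laplace (ENNReal.ofReal (a ^ (-α)) • Measure.pi fun _ : Unit => gammaNN α (a / b)) := by
    ext s
    have hs : 0 ≤ (s () : ℝ) := (s ()).2
    have h1 : laplace (ENNReal.ofReal (a ^ (-α)) • Measure.pi fun _ : Unit => gammaNN α (a / b)) s
        = ENNReal.ofReal (a ^ (-α)) * laplace (Measure.pi fun _ : Unit => gammaNN α (a / b)) s := by
      simp [laplace]
    rw [h1, laplace_pi, Finset.univ_unique, Finset.prod_singleton,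
      lintegral_exp_gammaNN hα hr (by positivity), ← ENNReal.ofReal_mul (by positivity),
      laplace, lintegral_map (by fun_prop) hY,
      lintegral_withDensity_eq_lintegral_mul₀ (by fun_prop) (by fun_prop)]
    have hae : ∀ᵐ ω ∂P, ((fun ω => ENNReal.ofReal (Real.exp (-(s₀ * V ω)))) *
        fun ω => ENNReal.ofReal (expFun s (Y ω))) ω =
          ENNReal.ofReal (Real.exp (-(s₀ * V ω + s () * Z ω))) := by
      filter_upwards [hZ0] with ω hω
      rw [Pi.mul_apply, ← ENNReal.ofReal_mul (Real.exp_pos _).le, neg_add, Real.exp_add]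
      simp [expFun, Y, hω]
    rw [lintegral_congr_ae hae, ← ofReal_integral_eq_lintegral_ofReal (hint _ hs)
      (.of_forall fun ω => (Real.exp_pos _).le), h _ hs]
    congr 1
    have hab : 0 < a + b * s () := by positivity
    have e : a / b / (a / b + s ()) = a / (a + b * s ()) := by field_simp
    change _ = a ^ (-α) * (a / b / (a / b + s ())) ^ α
    rw [e, Real.div_rpow ha.le hab.le, Real.rpow_neg ha.le]
    have := (Real.rpow_pos_of_pos ha α).ne'
    field_simp
  have hfin : IsFiniteMeasure (Q.map Y) := isFiniteMeasure_of_laplace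
      (φ := fun s => a ^ (-α) * (a / b / (a / b + s ())) ^ α) fun s => by
    rw [hlap]
    have h1 : laplace (ENNReal.ofReal (a ^ (-α)) • Measure.pi fun _ : Unit => gammaNN α (a / b)) s
        = ENNReal.ofReal (a ^ (-α)) * laplace (Measure.pi fun _ : Unit => gammaNN α (a / b)) s := by
      simp [laplace]
    rw [h1, laplace_pi, Finset.univ_unique, Finset.prod_singleton,
      lintegral_exp_gammaNN hα hr (by positivity), ← ENNReal.ofReal_mul (by positivity)]
  have hfin' : IsFiniteMeasure
      (ENNReal.ofReal (a ^ (-α)) • Measure.pi fun _ : Unit => gammaNN α (a / b)) :=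
    Measure.smul_finite _ ENNReal.ofReal_ne_top
  have hlaw := ext_of_laplace hlap
  have hQ : Q {ω | y < (Z ω).toNNReal} ≤
      ENNReal.ofReal (a ^ (-α) * ((1 - θ) ^ (-α) * Real.exp (-(θ * (a / b * y))))) := by
    have h1 : Q {ω | y < (Z ω).toNNReal} = (Q.map Y) (Set.univ.pi fun _ => Set.Ioi y) := by
      rw [Measure.map_apply hY (MeasurableSet.univ_pi fun _ => measurableSet_Ioi)]
      congr 1
      ext ω
      simp [Y]
    rw [h1, hlaw, Measure.smul_apply, Measure.pi_pi, Finset.univ_unique, Finset.prod_singleton,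
      smul_eq_mul, ENNReal.ofReal_mul (by positivity)]
    gcongr
    exact gammaNN_Ioi_le hα hr hθ0 hθ1 y
  have hms : MeasurableSet {ω | y < (Z ω).toNNReal} := measurableSet_lt (by fun_prop) (by fun_prop)
  have hmt : MeasurableSet {ω | V ω ≤ M ∧ y < Z ω} :=
    (measurableSet_le hV measurable_const).inter (measurableSet_lt measurable_const hZ)
  -- On `V ≤ M` the density of `Q` is at least `exp (-s₀ * M)`.
  have hlow : ENNReal.ofReal (Real.exp (-(s₀ * M))) * P {ω | V ω ≤ M ∧ y < Z ω} ≤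
      Q {ω | y < (Z ω).toNNReal} := by
    refine le_trans ?_ (measure_mono (show {ω | V ω ≤ M ∧ y < Z ω} ⊆ _ from fun ω hω =>
      Real.lt_toNNReal_iff_coe_lt.2 hω.2))
    rw [withDensity_apply _ hmt, ← setLIntegral_const]
    refine setLIntegral_mono (by fun_prop) fun ω hω => ENNReal.ofReal_le_ofReal ?_
    exact Real.exp_le_exp.2 (neg_le_neg (mul_le_mul_of_nonneg_left hω.1 hs₀))
  rw [ENNReal.ofReal_mul (Real.exp_pos _).le]
  calc P {ω | V ω ≤ M ∧ y < Z ω}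
      = ENNReal.ofReal (Real.exp (s₀ * M)) *
          (ENNReal.ofReal (Real.exp (-(s₀ * M))) * P {ω | V ω ≤ M ∧ y < Z ω}) := by
        rw [← mul_assoc, ← ENNReal.ofReal_mul (Real.exp_pos _).le, ← Real.exp_add]; simp
    _ ≤ _ := by gcongr; exact hlow.trans hQ

end Permanental

/-! ### Almost sure lower and upper bounds along the sequence -/

section Limsup

variable {lam f g : ℕ → ℝ} {α : ℝ} {Ω : Type*} [MeasurableSpace Ω] {P : Measure Ω}
  {X : T → Ω → ℝ}

theorem sum_fin_le_tsum {u : ℕ → ℝ} (hu : ∀ j, 0 ≤ u (j + 2)) (hs : Summable fun j => u (j + 2))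
    {N : ℕ} (hN : 2 ≤ N) (k : ℕ) : ∑ i : Fin k, u (N + i) ≤ ∑' j, u (j + 2) := by
  have h := hs.sum_le_tsum ((Finset.range k).map (addLeftEmbedding (N - 2))) fun j _ => hu j
  rw [Finset.sum_map] at h
  rw [Fin.sum_univ_eq_sum_range fun i => u (N + i)]
  refine le_trans (le_of_eq (Finset.sum_congr rfl fun i _ => ?_)) h
  congr 1
  simp only [addLeftEmbedding_apply]
  omega

theorem measure_forall_lt_le [IsProbabilityMeasure P] (hadm : Admissible lam f g) (hα : 0 < α)
    (hX : IsPermanentalProcess P α (U lam f g) X) {N : ℕ} (hN : 2 ≤ N) (k : ℕ) (t : ℕ → ℝ≥0) :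
    P {ω | ∀ i < k, X (pt (N + i)) ω ≤ t (N + i)} ≤
      ∏ i ∈ Finset.range k, gammaNN α (1 / lam (N + i)) (Set.Iic (t (N + i))) := by
  have h2 : ∀ i : Fin k, 2 ≤ N + i := fun i => by omega
  have hker : (Matrix.of fun i j : Fin k => U lam f g (pt (N + i)) (pt (N + j))) =
      Matrix.of fun i j : Fin k =>
        (if i = j then lam (N + i) else 0) + 1 + f (N + i) * g (N + j) := by
    ext i j
    simp only [Matrix.of_apply, U_pt_pt lam f g (h2 i) (h2 j), Nat.add_left_cancel_iff, Fin.ext_iff]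
  have hV := hX k fun i => pt (N + i)
  rw [hker] at hV
  have hf := fun i : Fin k => hadm.f_mem _ (h2 i)
  have hg := fun i : Fin k => hadm.g_mem _ (h2 i)
  have key := hV.measure_forall_le hα (fun i => hadm.lam_pos _ (h2 i))
    (fun i => ⟨(hf i).1.le, (hf i).2.le⟩) (fun i => ⟨(hg i).1.le, (hg i).2.le⟩)
    ((sum_fin_le_tsum (u := fun n => (1 - f n) / lam n) (fun j => div_nonneg
      (sub_nonneg.2 (hadm.f_mem _ (by omega)).2.le) (hadm.lam_pos _ (by omega)).le)
      hadm.f_summable hN k).trans hadm.f_sum_lt.le)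
    ((sum_fin_le_tsum (u := fun n => (1 - g n) / lam n) (fun j => div_nonneg
      (sub_nonneg.2 (hadm.g_mem _ (by omega)).2.le) (hadm.lam_pos _ (by omega)).le)
      hadm.g_summable hN k).trans hadm.g_sum_lt.le) (fun i => t (N + i))
  rw [Fin.prod_univ_eq_prod_range
    (fun i => gammaNN α (1 / lam (N + i)) (Set.Iic (t (N + i))))] at key
  refine le_trans (measure_mono ?_) key
  exact fun ω hω (i : Fin k) => hω (i : ℕ) i.isLt

theorem tendsto_sum_range_one_div_add (N : ℕ) :
    Tendsto (fun k => ∑ i ∈ Finset.range k, 1 / ((N + i : ℕ) : ℝ)) atTop atTop := by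
  have h : ¬ Summable fun i : ℕ => 1 / ((N + i : ℕ) : ℝ) := fun hs => by
    simp_rw [add_comm N] at hs
    exact Real.not_summable_one_div_natCast ((summable_nat_add_iff N).1 hs)
  exact (not_summable_iff_tendsto_nat_atTop_of_nonneg fun i => by positivity).1 h

/-- The probability of staying below the level from `N` on is at most a product of terms `1 - c / n
≤ exp (-c / n)`, which is `0` by divergence of the harmonic series. The gamma comparison replaces
independence of the `X (pt n)`. -/
theorem ae_frequently_lt [IsProbabilityMeasure P] (hadm : Admissible lam f g) (hα : 0 < α)
    (hX : IsPermanentalProcess P α (U lam f g) X) {c : ℝ} (hc0 : 0 < c) (hc1 : c < 1) :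
    ∀ᵐ ω ∂P, ∃ᶠ n : ℕ in atTop, c * (lam n * Real.log n) < X (pt n) ω := by
  -- With `δ = 1 / c - 1`, `(1 + δ) * c = 1` and the gamma tail bound at the level is exactly `c /
  -- n`.
  have hδ : 0 < 1 / c - 1 := by rw [sub_pos, one_lt_div hc0]; exact hc1
  obtain ⟨u, hu⟩ := exists_le_gammaNN_Ioi hα hδ
  have hlog : Tendsto (fun n : ℕ => c * Real.log n) atTop atTop :=
    (Real.tendsto_log_atTop.comp tendsto_natCast_atTop_atTop).const_mul_atTop hc0
  obtain ⟨N₀, hN₀⟩ := eventually_atTop.1 (hlog.eventually_ge_atTop u)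
  let t (n : ℕ) : ℝ≥0 := (c * (lam n * Real.log n)).toNNReal
  have hmain : ∀ n, max N₀ 2 ≤ n → gammaNN α (1 / lam n) (Set.Iic (t n)) ≤
      ENNReal.ofReal (Real.exp (-(c * (1 / (n : ℝ))))) := fun n hn => by
    have hn0 : N₀ ≤ n := (le_max_left _ _).trans hn
    have hn2 : 2 ≤ n := (le_max_right _ _).trans hn
    have hl := hadm.lam_pos n hn2
    have hnpos : 0 < (n : ℝ) := by positivity
    have hlogpos : 0 ≤ Real.log n := Real.log_natCast_nonneg n
    have hr : 0 < 1 / lam n := one_div_pos.2 hl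
    have := isProbabilityMeasure_gammaNN hα hr
    have ht : 1 / lam n * (t n : ℝ) = c * Real.log n := by
      rw [Real.coe_toNNReal _ (by positivity)]
      field_simp
    have h1 := hu _ hr (t n) (by rw [ht]; exact hN₀ n hn0)
    have h2 : Real.exp (-((1 + (1 / c - 1)) * (1 / lam n * t n))) / (1 + (1 / c - 1)) =
        c * (1 / (n : ℝ)) := by
      have e : -((1 + (1 / c - 1)) * (c * Real.log n)) = -Real.log n := by field_simp; ring
      rw [ht, e, Real.exp_neg, Real.exp_log hnpos]
      field_simp
      ring
    rw [h2] at h1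
    rw [← Set.compl_Ioi, prob_compl_eq_one_sub measurableSet_Ioi]
    calc 1 - gammaNN α (1 / lam n) (Set.Ioi (t n))
        ≤ ENNReal.ofReal 1 - ENNReal.ofReal (c * (1 / (n : ℝ))) := by
          rw [ENNReal.ofReal_one]; exact tsub_le_tsub_left h1 _
      _ = ENNReal.ofReal (1 - c * (1 / (n : ℝ))) := (ENNReal.ofReal_sub _ (by positivity)).symm
      _ ≤ _ := ENNReal.ofReal_le_ofReal (Real.one_sub_le_exp_neg _)
  have hzero : ∀ N, max N₀ 2 ≤ N →
      P {ω | ∀ n, N ≤ n → X (pt n) ω ≤ c * (lam n * Real.log n)} = 0 := fun N hN => by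
    have hN2 : 2 ≤ N := (le_max_right _ _).trans hN
    have hbound : ∀ k, P {ω | ∀ n, N ≤ n → X (pt n) ω ≤ c * (lam n * Real.log n)} ≤
        ENNReal.ofReal (Real.exp (-(c * ∑ i ∈ Finset.range k, 1 / ((N + i : ℕ) : ℝ)))) :=
        fun k => by
      refine le_trans (measure_mono ?_) ((measure_forall_lt_le hadm hα hX hN2 k t).trans ?_)
      · exact fun ω hω i _ => (hω (N + i) (by omega)).trans (Real.le_coe_toNNReal _)
      · rw [Finset.mul_sum, ← Finset.sum_neg_distrib, Real.exp_sum,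
          ENNReal.ofReal_prod_of_nonneg fun i _ => (Real.exp_pos _).le]
        exact Finset.prod_le_prod' fun i _ => hmain (N + i) (by omega)
    have hlim : Tendsto (fun k => ENNReal.ofReal
        (Real.exp (-(c * ∑ i ∈ Finset.range k, 1 / ((N + i : ℕ) : ℝ))))) atTop (𝓝 0) := by
      rw [← ENNReal.ofReal_zero]
      refine (ENNReal.continuous_ofReal.tendsto 0).comp (Real.tendsto_exp_neg_atTop_nhds_zero.comp
        ((tendsto_sum_range_one_div_add N).const_mul_atTop hc0))
    exact le_antisymm (ge_of_tendsto' hlim hbound) zero_le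
  have hall : ∀ᵐ ω ∂P, ∀ N, max N₀ 2 ≤ N →
      ¬ ∀ n, N ≤ n → X (pt n) ω ≤ c * (lam n * Real.log n) := by
    refine ae_all_iff.2 fun N => ?_
    by_cases hN : max N₀ 2 ≤ N
    · filter_upwards [measure_eq_zero_iff_ae_notMem.1 (hzero N hN)] with ω hω _ using hω
    · exact .of_forall fun ω h => absurd h hN
  filter_upwards [hall] with ω hω
  refine frequently_atTop.2 fun N => ?_
  have := hω (max N (max N₀ 2)) (le_max_right _ _)
  push Not at this
  obtain ⟨n, hn, h⟩ := this
  exact ⟨n, (le_max_left _ _).trans hn, h⟩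

theorem IsPermanentalProcess.measurable (hX : IsPermanentalProcess P α (U lam f g) X) (t : T) :
    Measurable (X t) :=
  measurable_pi_iff.1 (hX 1 fun _ => t).measurable 0

theorem IsPermanentalProcess.ae_nonneg (hX : IsPermanentalProcess P α (U lam f g) X) (t : T) :
    ∀ᵐ ω ∂P, 0 ≤ X t ω := by
  filter_upwards [(hX 1 fun _ => t).nonneg] with ω hω using hω 0

theorem integral_exp_zeroPt_pt (hadm : Admissible lam f g)
    (hX : IsPermanentalProcess P α (U lam f g) X) {n : ℕ} (hn : 2 ≤ n) {s₀ s : ℝ}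
    (hs₀ : 0 ≤ s₀) (hs : 0 ≤ s) :
    ∫ ω, Real.exp (-(s₀ * X zeroPt ω + s * X (pt n) ω)) ∂P =
      1 / ((1 + 2 * s₀) + (lam n + 1 + f n * g n + s₀ * (2 * lam n + (1 - f n) * (1 - g n))) * s)
        ^ α := by
  have h := (hX 2 ![zeroPt, pt n]).laplace ![s₀, s] (by
    intro i; fin_cases i <;> assumption)
  simp only [Fin.sum_univ_two, Matrix.cons_val_zero, Matrix.cons_val_one] at h
  rw [h, Matrix.det_fin_two]
  simp only [Matrix.add_apply, Matrix.mul_diagonal, Matrix.of_apply, Matrix.one_apply,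
    Matrix.cons_val_zero, Matrix.cons_val_one, U_zero_zero hadm, U_zero_pt hadm hn,
    U_pt_zero hadm hn, U_pt_pt lam f g hn hn]
  congr 2
  simp
  ring

theorem exists_summable_bound [IsProbabilityMeasure P] (hadm : Admissible lam f g)
    (hlog : Tendsto (fun n : ℕ => lam n * Real.log n) atTop atTop) (hα : 0 < α)
    (hX : IsPermanentalProcess P α (U lam f g) X) {c : ℝ} (hc : 1 < c) (M : ℝ) :
    ∃ K p : ℝ, 1 < p ∧ ∀ᶠ n : ℕ in atTop,
      P {ω | X zeroPt ω ≤ M ∧ c * (lam n * Real.log n) < X (pt n) ω} ≤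
        ENNReal.ofReal (K * (1 / (n : ℝ) ^ p)) := by
  have hc0 : 0 < c := by linarith
  -- Two factors `θ` are lost: one in the Chernoff bound, one in comparing the rate `a / b` with `1
  -- / lam n`.
  obtain ⟨θ, hθ0, hθ1, hcθ⟩ : ∃ θ : ℝ, 0 < θ ∧ θ < 1 ∧ 1 < c * θ ^ 2 := by
    refine ⟨(1 + 1 / c) / 2, by positivity, ?_, ?_⟩
    · have : 1 / c < 1 := by rwa [div_lt_one hc0]
      linarith
    · have h1 : c * ((1 + 1 / c) / 2) ^ 2 = 1 + (c - 1) ^ 2 / (4 * c) := by field_simp; ring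
      have : 0 < (c - 1) ^ 2 / (4 * c) := div_pos (pow_pos (by linarith) 2) (by linarith)
      linarith
  -- As `lam n → 0`, `a / b * lam n` tends to at least `2 * C / (2 + 2 * C)`, which must exceed `θ`.
  obtain ⟨C, hC0, hC⟩ : ∃ C : ℝ, 0 < C ∧ θ * (2 + 2 * C) < 2 * C := by
    refine ⟨2 * θ / (1 - θ), div_pos (by linarith) (by linarith), ?_⟩
    have : 1 - θ ≠ 0 := by linarith
    rw [← sub_pos]
    have e : 2 * (2 * θ / (1 - θ)) - θ * (2 + 2 * (2 * θ / (1 - θ))) = 2 * θ := by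
      field_simp; ring
    rw [e]; linarith
  -- Thus `c * θ ^ 2 = 1 + 2 * η`: one `η` pays for `exp (C * M / lam n)`, the other leaves the
  -- exponent `1 + η`.
  let η : ℝ := (c * θ ^ 2 - 1) / 2
  have hη : 0 < η := by simp only [η]; linarith
  have hh : Tendsto (fun n => (1 - f n) / lam n) atTop (𝓝 0) :=
    (tendsto_add_atTop_iff_nat 2).1 hadm.f_summable.tendsto_atTop_zero
  have hlim : Tendsto (fun n => θ * (lam n + 2 + C * (2 + (1 - f n) / lam n))) atTop
      (𝓝 (θ * (0 + 2 + C * (2 + 0)))) :=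
    ((hadm.lam_tendsto.add_const 2).add ((hh.const_add 2).const_mul C)).const_mul θ
  have hev := hlim.eventually_lt_const (u := 2 * C) (by linarith)
  refine ⟨(1 - θ) ^ (-α), 1 + η, by linarith, ?_⟩
  filter_upwards [hev, hlog.eventually_ge_atTop (C * M / η), eventually_ge_atTop 2]
    with n hn1 hn2 hn
  have hl := hadm.lam_pos n hn
  obtain ⟨hf0, hf1⟩ := hadm.f_mem n hn
  obtain ⟨hg0, hg1⟩ := hadm.g_mem n hn
  have hL : 0 ≤ Real.log n := Real.log_natCast_nonneg n
  have hn0 : 0 < (n : ℝ) := by positivity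
  have hfg1 : f n * g n ≤ 1 := mul_le_one₀ hf1.le hg0.le hg1.le
  have hhk1 : (1 - f n) * (1 - g n) ≤ 1 - f n :=
    mul_le_of_le_one_right (by linarith) (by linarith)
  have hhk0 : 0 ≤ (1 - f n) * (1 - g n) := mul_nonneg (by linarith) (by linarith)
  have hs₀ : 0 ≤ C / lam n := by positivity
  let a : ℝ := 1 + 2 * (C / lam n)
  let b : ℝ := lam n + 1 + f n * g n + C / lam n * (2 * lam n + (1 - f n) * (1 - g n))
  have ha1 : 1 ≤ a := by simp only [a]; linarith
  have hb : 0 < b := by positivity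
  have hab : θ ≤ a / b * lam n := by
    rw [div_mul_eq_mul_div, le_div_iff₀ hb]
    have e1 : a * lam n = lam n + 2 * C := by simp only [a]; field_simp
    have e2 : C / lam n * (2 * lam n + (1 - f n) * (1 - g n)) ≤ C * (2 + (1 - f n) / lam n) := by
      have : C * (2 + (1 - f n) / lam n) = C / lam n * (2 * lam n + (1 - f n)) := by
        field_simp
      rw [this]
      gcongr
    have e3 : b ≤ lam n + 2 + C * (2 + (1 - f n) / lam n) := by simp only [b]; linarith
    rw [e1]
    nlinarith [mul_le_mul_of_nonneg_left e3 hθ0.le]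
  have key := measure_le_and_lt_le (P := P) (hX.measurable zeroPt) (hX.measurable (pt n))
    (hX.ae_nonneg zeroPt) (hX.ae_nonneg (pt n)) hs₀ (a := a) (b := b) (by linarith) hb hα hθ0.le hθ1
    (fun s hs => integral_exp_zeroPt_pt hadm hX hn hs₀ hs) M (c * (lam n * Real.log n)).toNNReal
  rw [Real.coe_toNNReal _ (by positivity)] at key
  refine key.trans (ENNReal.ofReal_le_ofReal ?_)
  have ha2 : a ^ (-α) ≤ 1 := Real.rpow_le_one_of_one_le_of_nonpos ha1 (by linarith)
  have h1 : C / lam n * M ≤ η * Real.log n := by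
    rw [div_le_iff₀ hη] at hn2
    rw [div_mul_eq_mul_div, div_le_iff₀ hl]
    linarith
  have h2 : c * θ ^ 2 * Real.log n ≤ θ * (a / b * (c * (lam n * Real.log n))) := by
    have : θ * (a / b * (c * (lam n * Real.log n))) =
      θ * (a / b * lam n) * (c * Real.log n) := by ring
    rw [this]
    have : c * θ ^ 2 * Real.log n = θ * θ * (c * Real.log n) := by ring
    rw [this]
    gcongr
  have hθα : 0 ≤ (1 - θ) ^ (-α) := Real.rpow_nonneg (by linarith) _
  calc Real.exp (C / lam n * M) * (a ^ (-α) * ((1 - θ) ^ (-α) *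
        Real.exp (-(θ * (a / b * (c * (lam n * Real.log n)))))))
      ≤ Real.exp (C / lam n * M) * (1 * ((1 - θ) ^ (-α) *
        Real.exp (-(θ * (a / b * (c * (lam n * Real.log n))))))) := by gcongr
    _ = (1 - θ) ^ (-α) *
        Real.exp (C / lam n * M - θ * (a / b * (c * (lam n * Real.log n)))) := by
        rw [sub_eq_add_neg (C / lam n * M), Real.exp_add]; ring
    _ ≤ (1 - θ) ^ (-α) * Real.exp (Real.log n * -(1 + η)) := by
        gcongr
        have : c * θ ^ 2 = 1 + 2 * η := by simp only [η]; ring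
        rw [this] at h2
        linarith
    _ = (1 - θ) ^ (-α) * (1 / (n : ℝ) ^ (1 + η)) := by
        rw [← Real.rpow_def_of_pos hn0, Real.rpow_neg hn0.le, one_div]

/-- Borel–Cantelli on each event `X zeroPt ≤ M`; these events exhaust the space as `M` runs through
the naturals. -/
theorem ae_eventually_le [IsProbabilityMeasure P] (hadm : Admissible lam f g)
    (hlog : Tendsto (fun n : ℕ => lam n * Real.log n) atTop atTop) (hα : 0 < α)
    (hX : IsPermanentalProcess P α (U lam f g) X) {c : ℝ} (hc : 1 < c) :
    ∀ᵐ ω ∂P, ∀ᶠ n : ℕ in atTop, X (pt n) ω ≤ c * (lam n * Real.log n) := by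
  have hM : ∀ M : ℕ, ∀ᵐ ω ∂P, ∀ᶠ n : ℕ in atTop,
      ¬ (X zeroPt ω ≤ M ∧ c * (lam n * Real.log n) < X (pt n) ω) := fun M => by
    obtain ⟨K, p, hp, hev⟩ := exists_summable_bound hadm hlog hα hX hc M
    obtain ⟨N, hN⟩ := eventually_atTop.1 hev
    have hsum : Summable fun n : ℕ => K * (1 / ((n + N : ℕ) : ℝ) ^ p) :=
      ((summable_nat_add_iff N).2 (Real.summable_one_div_nat_rpow.2 hp)).mul_left K
    have hfin : ∑' n, P {ω | X zeroPt ω ≤ M ∧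
        c * (lam (n + N) * Real.log (n + N : ℕ)) < X (pt (n + N)) ω} ≠ ⊤ :=
      ne_top_of_le_ne_top hsum.tsum_ofReal_ne_top
        (ENNReal.tsum_le_tsum fun n => hN (n + N) (by omega))
    filter_upwards [ae_eventually_notMem hfin] with ω hω
    obtain ⟨N₁, hN₁⟩ := eventually_atTop.1 hω
    refine eventually_atTop.2 ⟨N₁ + N, fun n hn => ?_⟩
    have := hN₁ (n - N) (by omega)
    rwa [Nat.sub_add_cancel (by omega)] at this
  filter_upwards [ae_all_iff.2 hM] with ω hω
  obtain ⟨M, hM⟩ := exists_nat_ge (X zeroPt ω)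
  filter_upwards [hω M] with n hn
  exact not_lt.1 fun h => hn ⟨hM, h⟩

end Limsup

end Kolmogorov

/-! ### The limsup from the two almost sure bounds -/

theorem theorem1p2 (lam f g : ℕ → ℝ) (hadm : Kolmogorov.Admissible lam f g)
    (hlog : Tendsto (fun n : ℕ => lam n * Real.log n) atTop atTop)
    (α : ℝ) (hα : 0 < α)
    {Ω : Type*} [MeasurableSpace Ω] (P : Measure Ω) [IsProbabilityMeasure P]
    (X : Kolmogorov.T → Ω → ℝ)
    (hX : Kolmogorov.IsPermanentalProcess P α (Kolmogorov.U lam f g) X) :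
    ∀ᵐ ω ∂P,
      limsup (fun n : ℕ => ((X (Kolmogorov.pt n) ω / (lam n * Real.log n) : ℝ) : EReal)) atTop
        = 1 := by
  have hpos : ∀ᶠ n : ℕ in atTop, 0 < lam n * Real.log n := hlog.eventually_gt_atTop 0
  have hup : ∀ᵐ ω ∂P, ∀ k : ℕ, ∀ᶠ n : ℕ in atTop,
      X (Kolmogorov.pt n) ω ≤ (1 + 1 / ((k : ℝ) + 1)) * (lam n * Real.log n) :=
    ae_all_iff.2 fun k => Kolmogorov.ae_eventually_le hadm hlog hα hX (by
      have : 0 < 1 / ((k : ℝ) + 1) := by positivity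
      linarith)
  -- The shift by `2` keeps the constant strictly positive already at `k = 0`.
  have hlow : ∀ᵐ ω ∂P, ∀ k : ℕ, ∃ᶠ n : ℕ in atTop,
      (1 - 1 / ((k : ℝ) + 2)) * (lam n * Real.log n) < X (Kolmogorov.pt n) ω :=
    ae_all_iff.2 fun k => by
      have h0 : 0 < 1 / ((k : ℝ) + 2) := by positivity
      have h1 : 1 / ((k : ℝ) + 2) < 1 := by
        rw [div_lt_one (by positivity)]
        have : (0 : ℝ) ≤ k := k.cast_nonneg
        linarith
      exact Kolmogorov.ae_frequently_lt hadm hα hX (by linarith) (by linarith)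
  filter_upwards [hup, hlow] with ω h1 h2
  apply le_antisymm
  · have hle : ∀ k : ℕ, limsup (fun n : ℕ =>
        ((X (Kolmogorov.pt n) ω / (lam n * Real.log n) : ℝ) : EReal)) atTop ≤
          ((1 + 1 / ((k : ℝ) + 1) : ℝ) : EReal) := fun k => by
      refine limsup_le_of_le (by isBoundedDefault) ?_
      filter_upwards [h1 k, hpos] with n hn hp
      exact EReal.coe_le_coe_iff.2 ((div_le_iff₀ hp).2 hn)
    have hlim : Tendsto (fun k : ℕ => ((1 + 1 / ((k : ℝ) + 1) : ℝ) : EReal)) atTop (𝓝 1) := by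
      have h := tendsto_one_div_add_atTop_nhds_zero_nat (𝕜 := ℝ).const_add 1
      rw [add_zero] at h
      exact (continuous_coe_real_ereal.tendsto 1).comp h
    exact ge_of_tendsto' hlim hle
  · have hle : ∀ k : ℕ, ((1 - 1 / ((k : ℝ) + 2) : ℝ) : EReal) ≤
        limsup (fun n : ℕ =>
          ((X (Kolmogorov.pt n) ω / (lam n * Real.log n) : ℝ) : EReal)) atTop := fun k => by
      refine le_limsup_of_frequently_le ?_ (by isBoundedDefault)
      refine ((h2 k).and_eventually hpos).mono fun n hn => ?_
      exact EReal.coe_le_coe_iff.2 ((le_div_iff₀ hn.2).2 hn.1.le)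
    have hlim : Tendsto (fun k : ℕ => ((1 - 1 / ((k : ℝ) + 2) : ℝ) : EReal)) atTop (𝓝 1) := by
      have h : Tendsto (fun k : ℕ => 1 - 1 / ((k : ℝ) + 2)) atTop (𝓝 (1 - 0)) := by
        refine Tendsto.const_sub 1 ?_
        exact tendsto_const_nhds.div_atTop
          (tendsto_atTop_add_const_right _ 2 tendsto_natCast_atTop_atTop)
      rw [sub_zero] at h
      exact (continuous_coe_real_ereal.tendsto 1).comp h
    exact le_of_tendsto' hlim hle
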